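/- Let $\mathcal X,\mathcal Y$ be finite sets and $c:\mathcal X\times\mathcal Y\to\mathbb R$ a cost function. Write $S=\mathcal X\times\mathcal Y$, and let $\Delta_S$ be the set of probability vectors on $S$. For matrices $P\in\mathbb R^{\mathcal X\times\mathcal X}$ and $Q\in\mathbb R^{\mathcal Y\times\mathcal Y}$, let $\Pi_{TC}(P,Q)$ be the set of transition matrices $R$ on $S$ such that each row $R((x,y),\cdot)\in\Delta_S$ has marginals $P(x,\cdot)$ and $Q(y,\cdot)$, i.e. $\sum_{y'}R((x,y),(x',y'))=P(x,x')$ and $\sum_{x'}R((x,y),(x',y'))=Q(y,y')$ for all $x,x'\in\mathcal X$ and $y,y'\in\mathcal Y$. For $\eta>0$ let $\Pi^\eta_{TC}(P,Q)$ be the set of those $R\in\Pi_{TC}(P,Q)$ with $\mathcal K\big(R((x,y),\cdot)\,\|\,P(x,\cdot)\otimes Q(y,\cdot)\big)\le\eta$ for all $(x,y)\in S$, where $\mathcal K(u\|v)=\sum_s u(s)\log(u(s)/v(s))$ is the Kullback--Leibler divergence (with $0\log(0/0)=0$, and $\mathcal K(u\|v)=+\infty$ if $u(s)>0=v(s)$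 for some $s$). Let $\rho(P,Q)$ be the optimal value, and $\Phi^*(P,Q)$ the set of optimal solutions $(\lambda,R)$, of the program $$\text{minimize } \langle c,\lambda\rangle\quad\text{subject to}\quad \lambda\in\Delta_S,\ R\in\Pi_{TC}(P,Q),\ \lambda R=\lambda,$$ and let $\rho_\eta(P,Q)$, $\Phi^*_\eta(P,Q)$ be the optimal value and the set of optimal solutions of the same program with $\Pi^\eta_{TC}(P,Q)$ in place of $\Pi_{TC}(P,Q)$. (An infeasible program has value $+\infty$ and no optimal solution.) For sets $A_0,A_1,\dots$ in a topological space, $\limsup_{n\to\infty}A_n:=\bigcap_{n\ge0}\operatorname{cl}\big(\bigcup_{m\ge n}A_m\big)$; pairs $(\lambda,R)$ carry the Euclidean topology of $\mathbb R^{S}\times\mathbb R^{S\times S}$. Let $X=(X_i)_{i\ge0}$ and $Y=(Y_i)_{i\ge0}$ be processes on a common probability space, with values in $\mathcal X$ and $\mathcal Y$ respectively, each of them stationary and ergodic (no Markov property and no joint stationarity is assumed). Let $$P(x,x')=\frac{\mathbb P(X_0=x,\,X_1=x')}{\mathbb P(X_0=x)},\qquad \hat P_n(x,x')=\frac{\#\{0\le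 i\le n-2: X_i=x,\,X_{i+1}=x'\}}{\#\{0\le i\le n-2: X_i=x\}}$$ be the one-step transition matrix of $X$ and its estimate by relative frequencies from the $n$ observations $X_0,\dots,X_{n-1}$, with the convention $0/0=0$, and define $Q$, $\hat Q_n$ in the same way from $Y$. Then, with probability one, the following hold: * $\rho(\hat P_n,\hat Q_n)\to\rho(P,Q)$ and $\limsup_{n\to\infty}\Phi^*(\hat P_n,\hat Q_n)\subseteq\Phi^*(P,Q)$; * for every $\eta>0$, $\rho_\eta(\hat P_n,\hat Q_n)\to\rho_\eta(P,Q)$ and $\limsup_{n\to\infty}\Phi^*_\eta(\hat P_n,\hat Q_n)\subseteq\Phi^*_\eta(P,Q)$. -/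

import Mathlib

open MeasureTheory Filter Topology

namespace OTC

section Coupling

variable {𝒳 𝒴 : Type*} [Fintype 𝒳] [Fintype 𝒴]

/-- The probability vectors on `𝒳 × 𝒴` with marginals `u` and `v`. -/
def couplings (u : 𝒳 → ℝ) (v : 𝒴 → ℝ) : Set (𝒳 × 𝒴 → ℝ) :=
  {r | r ∈ stdSimplex ℝ (𝒳 × 𝒴) ∧ (∀ x, ∑ y, r (x, y) = u x) ∧ (∀ y, ∑ x, r (x, y) = v y)}

/-- The transition couplings of `P` and `Q`: each row `R ((x, y), ·)` is a coupling of
`P (x, ·)` and `Q (y, ·)`. -/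
def transitionCouplings (P : Matrix 𝒳 𝒳 ℝ) (Q : Matrix 𝒴 𝒴 ℝ) :
    Set (Matrix (𝒳 × 𝒴) (𝒳 × 𝒴) ℝ) :=
  {R | ∀ s, R s ∈ couplings (P s.1) (Q s.2)}

open Classical in
/-- Kullback-Leibler divergence of vectors on a finite set, `+∞` if `u` charges a zero of `v`.
Real division and logarithm give the convention `0 log (0 / 0) = 0`. -/
noncomputable def klVec {S : Type*} [Fintype S] (u v : S → ℝ) : EReal :=
  if ∀ s, v s = 0 → u s = 0 then ((∑ s, u s * Real.log (u s / v s) : ℝ) : EReal) else ⊤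

/-- The independent transition coupling `P ⊗ Q`. -/
def indep (P : Matrix 𝒳 𝒳 ℝ) (Q : Matrix 𝒴 𝒴 ℝ) : Matrix (𝒳 × 𝒴) (𝒳 × 𝒴) ℝ :=
  fun s s' => P s.1 s'.1 * Q s.2 s'.2

/-- The transition couplings whose rows are within divergence `η` of those of `P ⊗ Q`. -/
def transitionCouplingsEta (η : ℝ) (P : Matrix 𝒳 𝒳 ℝ) (Q : Matrix 𝒴 𝒴 ℝ) :
    Set (Matrix (𝒳 × 𝒴) (𝒳 × 𝒴) ℝ) :=
  {R | R ∈ transitionCouplings P Q ∧ ∀ s, klVec (R s) (indep P Q s) ≤ (η : EReal)}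

end Coupling

section Program

variable {S : Type*} [Fintype S]

/-- Pairs `(lam, R)` with `R ∈ C` and `lam` a stationary distribution of `R`. -/
def feasible (C : Set (Matrix S S ℝ)) : Set ((S → ℝ) × Matrix S S ℝ) :=
  {z | z.1 ∈ stdSimplex ℝ S ∧ z.2 ∈ C ∧ Matrix.vecMul z.1 z.2 = z.1}

/-- The optimal value of: minimize `⟨c, lam⟩` over `(lam, R) ∈ feasible C`
(`+∞` if the program is infeasible). -/
noncomputable def optimalValue (c : S → ℝ) (C : Set (Matrix S S ℝ)) : EReal :=
  ⨅ z ∈ feasible C, ((c ⬝ᵥ z.1 : ℝ) : EReal)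

/-- The set of optimal solutions of: minimize `⟨c, lam⟩` over `(lam, R) ∈ feasible C`. -/
def optimalSolutions (c : S → ℝ) (C : Set (Matrix S S ℝ)) : Set ((S → ℝ) × Matrix S S ℝ) :=
  {z | z ∈ feasible C ∧ ∀ w ∈ feasible C, c ⬝ᵥ z.1 ≤ c ⬝ᵥ w.1}

end Program

section OptimalTransitionCoupling

variable {𝒳 𝒴 : Type*} [Fintype 𝒳] [Fintype 𝒴]

/-- The optimal transition coupling cost `ρ(P, Q)`. -/
noncomputable def rho (c : 𝒳 × 𝒴 → ℝ) (P : Matrix 𝒳 𝒳 ℝ) (Q : Matrix 𝒴 𝒴 ℝ) : EReal :=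
  optimalValue c (transitionCouplings P Q)

/-- The optimal solutions `Φ*(P, Q)`. -/
def PhiStar (c : 𝒳 × 𝒴 → ℝ) (P : Matrix 𝒳 𝒳 ℝ) (Q : Matrix 𝒴 𝒴 ℝ) :
    Set ((𝒳 × 𝒴 → ℝ) × Matrix (𝒳 × 𝒴) (𝒳 × 𝒴) ℝ) :=
  optimalSolutions c (transitionCouplings P Q)

/-- The entropic optimal transition coupling cost `ρ_η(P, Q)`. -/
noncomputable def rhoEta (c : 𝒳 × 𝒴 → ℝ) (η : ℝ) (P : Matrix 𝒳 𝒳 ℝ) (Q : Matrix 𝒴 𝒴 ℝ) :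
    EReal :=
  optimalValue c (transitionCouplingsEta η P Q)

/-- The entropic optimal solutions `Φ*_η(P, Q)`. -/
def PhiStarEta (c : 𝒳 × 𝒴 → ℝ) (η : ℝ) (P : Matrix 𝒳 𝒳 ℝ) (Q : Matrix 𝒴 𝒴 ℝ) :
    Set ((𝒳 × 𝒴 → ℝ) × Matrix (𝒳 × 𝒴) (𝒳 × 𝒴) ℝ) :=
  optimalSolutions c (transitionCouplingsEta η P Q)

end OptimalTransitionCoupling

/-- Upper limit of a sequence of sets in a topological space. -/
def setLimsup {Z : Type*} [TopologicalSpace Z] (A : ℕ → Set Z) : Set Z :=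
  ⋂ n, closure (⋃ m ≥ n, A m)

section Observations

variable {Ω 𝒳 : Type*}

/-- The left shift on sequences. -/
def shift (u : ℕ → 𝒳) : ℕ → 𝒳 := fun i => u (i + 1)

/-- The process `X` is stationary and ergodic: the left shift preserves the law of
`(X 0, X 1, …)` and is ergodic for it. -/
def StationaryErgodic [MeasurableSpace Ω] [MeasurableSpace 𝒳] (μ : Measure Ω)
    (X : ℕ → Ω → 𝒳) : Prop :=
  Ergodic (shift : (ℕ → 𝒳) → (ℕ → 𝒳)) (μ.map (fun ω i => X i ω))

/-- The one-step transition matrix `μ(X 0 = x, X 1 = x') / μ(X 0 = x)`, with `0 / 0 = 0`. -/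
noncomputable def oneStepMatrix [MeasurableSpace Ω] (μ : Measure Ω) (X : ℕ → Ω → 𝒳) :
    Matrix 𝒳 𝒳 ℝ :=
  fun x x' => μ.real {ω | X 0 ω = x ∧ X 1 ω = x'} / μ.real {ω | X 0 ω = x}

/-- The relative frequencies of transitions in the first `n` observations `u 0, …, u (n - 1)`:
the number of transitions from `x` to `x'` divided by the number of transitions from `x`,
with `0 / 0 = 0`. -/
noncomputable def empiricalMatrix [DecidableEq 𝒳] (u : ℕ → 𝒳) (n : ℕ) : Matrix 𝒳 𝒳 ℝ :=
  fun x x' =>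
    (((Finset.range (n - 1)).filter (fun i => u i = x ∧ u (i + 1) = x')).card : ℝ) /
      (((Finset.range (n - 1)).filter (fun i => u i = x)).card : ℝ)

end Observations

end OTC

/-!
By Birkhoff's theorem the empirical matrices converge almost surely to the true ones, and
transitions of probability zero never occur, so the supports are contained in those of the limits.
On vectors whose supports shrink in this way the Kullback-Leibler divergence is continuous, hence
limits of feasible pairs are feasible.

Conversely, let `(lam, R)` be feasible in the limit. It suffices that `lam` is a limit of
distributions feasible for the perturbed programs. Mixing with the independent coupling, at each
state in proportion to the posterior probability of its stationary distribution, keeps the mixture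
stationary; it makes `lam` positive, `R` positive wherever `P ⊗ Q` is, and the divergence
constraints strict. The marginals of such an `R` can then be adjusted to the empirical ones, which
gives `Rₙ → R`.

Since `R` may have several stationary distributions, that of `Rₙ` has to be chosen: averaging along
`Rₙ` yields one that agrees with `lam` on the harmonic functions of `Rₙ`. A limit `lam * g` of these
is stationary for `R`, so `g` is constant along the transitions of `R`, hence harmonic for all large
`n`. Thus `∑ lam * g ^ 2 = ∑ lam * g = 1`, which forces `g = 1`.
-/

namespace OTC

section Ergodic

variable {α : Type*} {T : α → α} {g : α → ℝ}

/-- The maximum of the Birkhoff sums of `g` of length at most `n`, including the empty sum `0`,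
defined by the recursion `Mₙ₊₁ = max 0 (g + Mₙ ∘ T)`. -/
noncomputable def birkhoffMax (T : α → α) (g : α → ℝ) : ℕ → α → ℝ
  | 0 => fun _ => 0
  | n + 1 => fun x => max 0 (g x + birkhoffMax T g n (T x))

lemma birkhoffMax_nonneg (n : ℕ) (x : α) : 0 ≤ birkhoffMax T g n x := by
  cases n with
  | zero => exact le_rfl
  | succ n => exact le_max_left _ _

lemma birkhoffMax_le_succ (n : ℕ) (x : α) : birkhoffMax T g n x ≤ birkhoffMax T g (n + 1) x := by
  induction n generalizing x with
  | zero => exact birkhoffMax_nonneg 1 x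
  | succ n ih => exact max_le_max le_rfl (by gcongr; exact ih (T x))

lemma monotone_birkhoffMax (x : α) : Monotone fun n => birkhoffMax T g n x :=
  monotone_nat_of_le_succ fun n => birkhoffMax_le_succ n x

lemma birkhoffSum_le_birkhoffMax (n : ℕ) (x : α) :
    birkhoffSum T g n x ≤ birkhoffMax T g n x := by
  induction n generalizing x with
  | zero => exact (birkhoffSum_zero T g x).le
  | succ n ih =>
    rw [birkhoffSum_succ']
    exact (add_le_add_right (ih (T x)) _).trans (le_max_right _ _)

lemma birkhoffMax_succ_sub (n : ℕ) (x : α) :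
    birkhoffMax T g (n + 1) x - birkhoffMax T g n (T x) = max (-birkhoffMax T g n (T x)) (g x) := by
  rw [birkhoffMax, ← max_sub_sub_right, zero_sub, add_sub_cancel_right]

lemma abs_birkhoffMax_succ_sub_le (n : ℕ) (x : α) :
    |birkhoffMax T g (n + 1) x - birkhoffMax T g n (T x)| ≤ |g x| := by
  have h := birkhoffMax_nonneg (T := T) (g := g) n (T x)
  rw [birkhoffMax_succ_sub, abs_le]
  exact ⟨(neg_abs_le _).trans (le_max_right _ _),
    max_le ((neg_nonpos.2 h).trans (abs_nonneg _)) (le_abs_self _)⟩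

lemma bddAbove_birkhoffMax_apply_iff (x : α) :
    BddAbove (Set.range fun n => birkhoffMax T g n (T x)) ↔
      BddAbove (Set.range fun n => birkhoffMax T g n x) := by
  constructor
  · rintro ⟨C, hC⟩
    refine ⟨max 0 (g x + C), Set.forall_mem_range.2 fun n => ?_⟩
    exact (birkhoffMax_le_succ n x).trans (max_le_max le_rfl (by gcongr; exact hC ⟨n, rfl⟩))
  · rintro ⟨C, hC⟩
    refine ⟨C - g x, Set.forall_mem_range.2 fun n => le_sub_iff_add_le'.2 ?_⟩
    exact (le_max_right _ _).trans (hC ⟨n + 1, rfl⟩)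

lemma eventually_birkhoffMax_succ_sub_eq {x : α}
    (hx : ¬ BddAbove (Set.range fun n => birkhoffMax T g n x)) :
    ∀ᶠ n in atTop, birkhoffMax T g (n + 1) x - birkhoffMax T g n (T x) = g x := by
  have hlarge : ∃ N, -g x < birkhoffMax T g N (T x) := by
    by_contra! h
    exact hx ((bddAbove_birkhoffMax_apply_iff x).1 ⟨_, Set.forall_mem_range.2 h⟩)
  obtain ⟨N, hN⟩ := hlarge
  filter_upwards [eventually_ge_atTop N] with n hn
  rw [birkhoffMax_succ_sub, max_eq_right]
  exact (neg_lt.1 (hN.trans_le (monotone_birkhoffMax (T x) hn))).le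

variable [MeasurableSpace α] {μ : Measure α}

lemma measurable_birkhoffMax (hT : Measurable T) (hg : Measurable g) (n : ℕ) :
    Measurable (birkhoffMax T g n) := by
  induction n with
  | zero => exact measurable_const
  | succ n ih => exact measurable_const.max (hg.add (ih.comp hT))

lemma integrable_birkhoffMax [IsFiniteMeasure μ] (hT : MeasurePreserving T μ μ)
    (hg : Integrable g μ) (n : ℕ) : Integrable (birkhoffMax T g n) μ := by
  induction n with
  | zero => exact integrable_const _
  | succ n ih => exact (integrable_const _).sup (hg.add (hT.integrable_comp_of_integrable ih))

lemma integral_birkhoffMax_succ_sub_nonneg [IsFiniteMeasure μ] (hT : MeasurePreserving T μ μ)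
    (hg : Integrable g μ) (n : ℕ) :
    0 ≤ ∫ x, (birkhoffMax T g (n + 1) x - birkhoffMax T g n (T x)) ∂μ := by
  have hM := integrable_birkhoffMax hT hg
  have hcomp : ∫ x, birkhoffMax T g n (T x) ∂μ = ∫ x, birkhoffMax T g n x ∂μ := by
    rw [← integral_map hT.aemeasurable (hT.map_eq.symm ▸ (hM n).aestronglyMeasurable), hT.map_eq]
  have hMT : Integrable (fun x => birkhoffMax T g n (T x)) μ :=
    hT.integrable_comp_of_integrable (hM n)
  rw [integral_sub (hM _) hMT, hcomp, sub_nonneg]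
  exact integral_mono (hM n) (hM (n + 1)) (birkhoffMax_le_succ n)

/- Where the maxima are unbounded, `Mₙ₊₁ - Mₙ ∘ T` is eventually `g`; its integrals are nonnegative
by invariance of `μ`. -/
lemma integral_nonneg_of_ae_not_bddAbove_birkhoffMax [IsFiniteMeasure μ]
    (hT : MeasurePreserving T μ μ) (hg : Integrable g μ)
    (h : ∀ᵐ x ∂μ, ¬ BddAbove (Set.range fun n => birkhoffMax T g n x)) : 0 ≤ ∫ x, g x ∂μ := by
  have hM := integrable_birkhoffMax hT hg
  refine ge_of_tendsto' (tendsto_integral_of_dominated_convergence (fun x => |g x|)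
    (fun n => ((hM (n + 1)).sub (hT.integrable_comp_of_integrable (hM n))).aestronglyMeasurable)
    hg.abs (fun n => Eventually.of_forall fun x => abs_birkhoffMax_succ_sub_le n x) ?_)
    (integral_birkhoffMax_succ_sub_nonneg hT hg)
  filter_upwards [h] with x hx
  exact tendsto_const_nhds.congr' ((eventually_birkhoffMax_succ_sub_eq hx).mono fun _ => Eq.symm)

lemma ae_bddAbove_birkhoffSum_of_integral_neg [IsFiniteMeasure μ] (hT : Ergodic T μ)
    (hgm : Measurable g) (hg : Integrable g μ) (hneg : ∫ x, g x ∂μ < 0) :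
    ∀ᵐ x ∂μ, BddAbove (Set.range fun n => birkhoffSum T g n x) := by
  have hmeas : MeasurableSet {x | BddAbove (Set.range fun n => birkhoffMax T g n x)} :=
    measurableSet_bddAbove_range fun n => measurable_birkhoffMax hT.measurable hgm n
  rcases hT.toPreErgodic.ae_mem_or_ae_notMem hmeas (Set.ext bddAbove_birkhoffMax_apply_iff)
    with hbdd | hunbdd
  · filter_upwards [hbdd] with x ⟨C, hC⟩
    exact ⟨C, Set.forall_mem_range.2 fun n => (birkhoffSum_le_birkhoffMax n x).trans (hC ⟨n, rfl⟩)⟩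
  · exact absurd (integral_nonneg_of_ae_not_bddAbove_birkhoffMax hT.toMeasurePreserving hg hunbdd)
      hneg.not_ge

lemma ae_eventually_birkhoffAverage_lt [IsProbabilityMeasure μ] (hT : Ergodic T μ)
    (hgm : Measurable g) (hg : Integrable g μ) {a : ℝ} (ha : ∫ x, g x ∂μ < a) :
    ∀ᵐ x ∂μ, ∀ᶠ n in atTop, birkhoffAverage ℝ T g n x < a := by
  obtain ⟨b, hgb, hba⟩ := exists_between ha
  have hneg : ∫ x, (g x - b) ∂μ < 0 := by
    rw [integral_sub hg (integrable_const b), integral_const, probReal_univ, one_smul]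
    exact sub_neg.2 hgb
  filter_upwards [ae_bddAbove_birkhoffSum_of_integral_neg hT (hgm.sub measurable_const)
    (hg.sub (integrable_const b)) hneg] with x ⟨C, hC⟩
  filter_upwards [eventually_gt_atTop 0, (tendsto_natCast_atTop_atTop.atTop_mul_const
    (sub_pos.2 hba)).eventually_gt_atTop C] with n hn hCn
  have hsum : birkhoffSum T g n x - n * b ≤ C := by
    simpa only [birkhoffSum, Pi.sub_apply, Finset.sum_sub_distrib, Finset.sum_const,
      Finset.card_range, nsmul_eq_mul] using hC ⟨n, rfl⟩
  rw [birkhoffAverage, smul_eq_mul, inv_mul_lt_iff₀ (Nat.cast_pos.2 hn)]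
  linarith

theorem ae_tendsto_birkhoffAverage [IsProbabilityMeasure μ] (hT : Ergodic T μ)
    (hgm : Measurable g) (hg : Integrable g μ) :
    ∀ᵐ x ∂μ, Tendsto (birkhoffAverage ℝ T g · x) atTop (𝓝 (∫ y, g y ∂μ)) := by
  have hupper : ∀ {f : α → ℝ}, Measurable f → Integrable f μ →
      ∀ᵐ x ∂μ, ∀ q : ℚ, ∫ y, f y ∂μ < q → ∀ᶠ n in atTop, birkhoffAverage ℝ T f n x < q :=
    fun hfm hf => ae_all_iff.2 fun _ => ae_all_iff.2 (ae_eventually_birkhoffAverage_lt hT hfm hf)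
  filter_upwards [hupper hgm hg, hupper hgm.neg hg.neg] with x habove hbelow
  refine tendsto_order.2 ⟨fun a ha => ?_, fun a ha => ?_⟩
  · obtain ⟨q, hq, hqa⟩ := exists_rat_btwn (neg_lt_neg ha)
    filter_upwards [hbelow q (by simpa only [Pi.neg_apply, integral_neg] using hq)] with n hn
    rw [birkhoffAverage_neg, Pi.neg_apply, Pi.neg_apply] at hn
    exact neg_lt_neg_iff.1 (hn.trans hqa)
  · obtain ⟨q, hq, hqa⟩ := exists_rat_btwn ha
    exact (habove q hq).mono fun n hn => hn.trans hqa

end Ergodic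

section SetLimsup

variable {Z : Type*} [TopologicalSpace Z] {A : ℕ → Set Z} {w : Z}

lemma mem_setLimsup_iff_frequently :
    w ∈ setLimsup A ↔ ∃ᶠ p in atTop ×ˢ 𝓝 w, p.2 ∈ A p.1 := by
  rw [(atTop_basis.prod (𝓝 w).basis_sets).frequently_iff]
  simp only [setLimsup, Set.mem_iInter, mem_closure_iff_nhds, Set.Nonempty, Set.mem_inter_iff,
    Set.mem_iUnion, Set.mem_prod, Set.mem_Ici, true_and, Prod.forall, Prod.exists, id]
  exact ⟨fun h n V hV => let ⟨z, hz, m, hm, hzA⟩ := h n V hV; ⟨m, z, ⟨hm, hz⟩, hzA⟩,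
    fun h n V hV => let ⟨m, z, ⟨hm, hz⟩, hzA⟩ := h n V hV; ⟨z, hz, m, hm, hzA⟩⟩

lemma exists_filter_of_mem_setLimsup (hw : w ∈ setLimsup A) :
    ∃ l : Filter (ℕ × Z), l.NeBot ∧ Tendsto Prod.fst l atTop ∧ Tendsto Prod.snd l (𝓝 w) ∧
      ∀ᶠ p in l, p.2 ∈ A p.1 :=
  ⟨(atTop ×ˢ 𝓝 w) ⊓ 𝓟 {p | p.2 ∈ A p.1},
    frequently_mem_iff_neBot.1 (mem_setLimsup_iff_frequently.1 hw),
    tendsto_fst.mono_left inf_le_left, tendsto_snd.mono_left inf_le_left,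
    mem_inf_of_right (mem_principal_self _)⟩

lemma setLimsup_subset_of_isClosed {F : Set Z} (hF : IsClosed F) (hAF : ∀ n, A n ⊆ F) :
    setLimsup A ⊆ F :=
  (Set.iInter_subset _ 0).trans (closure_minimal (Set.iUnion₂_subset fun m _ => hAF m) hF)

lemma mapsTo_setLimsup {Z' : Type*} [TopologicalSpace Z'] {A' : ℕ → Set Z'} {f : Z → Z'}
    (hf : Continuous f) (h : ∀ n, Set.MapsTo f (A n) (A' n)) :
    Set.MapsTo f (setLimsup A) (setLimsup A') := fun w hw =>
  mem_setLimsup_iff_frequently.2 <| (tendsto_id.prodMap (hf.tendsto w)).frequently <|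
    (mem_setLimsup_iff_frequently.1 hw).mono fun p hp => h p.1 hp

lemma eventually_subset_of_setLimsup_subset {K U : Set Z} (hK : IsCompact K) (hAK : ∀ n, A n ⊆ K)
    (hU : IsOpen U) (h : setLimsup A ⊆ U) : ∀ᶠ n in atTop, A n ⊆ U := by
  have hanti : Antitone fun n => closure (⋃ m ≥ n, A m) := fun _ _ hij =>
    closure_mono (Set.biUnion_mono (fun _ hm => hij.trans hm) fun _ _ => le_rfl)
  obtain ⟨N, hN⟩ := (hK.diff hU).elim_directed_family_closed
    (fun n => closure (⋃ m ≥ n, A m)) (fun _ => isClosed_closure)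
    (Set.eq_empty_of_forall_notMem fun _ hw => hw.1.2 (h hw.2)) hanti.directed_ge
  filter_upwards [eventually_ge_atTop N] with n hn z hz
  by_contra hzU
  exact (hN.subset ⟨⟨hAK n hz, hzU⟩, subset_closure (Set.mem_biUnion hn hz)⟩).elim

end SetLimsup

section Minimization

variable {Z β : Type*} [TopologicalSpace Z] {A : ℕ → Set Z} {B : Set Z}

lemma tendsto_iInf_of_setLimsup_subset [CompleteLinearOrder β] [DenselyOrdered β]
    [TopologicalSpace β] [OrderTopology β] {f : Z → β} (hf : LowerSemicontinuous f)
    {K : Set Z} (hK : IsCompact K) (hAK : ∀ n, A n ⊆ K)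
    (hAB : setLimsup A ⊆ B) (hBA : ∀ w ∈ B, ∀ b > f w, ∀ᶠ n in atTop, ∃ z ∈ A n, f z < b) :
    Tendsto (fun n => ⨅ z ∈ A n, f z) atTop (𝓝 (⨅ z ∈ B, f z)) := by
  refine tendsto_order.2 ⟨fun a ha => ?_, fun b hb => ?_⟩
  · obtain ⟨a', haa', ha'⟩ := exists_between ha
    filter_upwards [eventually_subset_of_setLimsup_subset hK hAK (hf.isOpen_preimage a')
      fun w hw => ha'.trans_le (iInf₂_le w (hAB hw))] with n hn
    exact haa'.trans_le (le_iInf₂ fun z hz => (hn hz).le)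
  · obtain ⟨w, hw, hwb⟩ : ∃ w ∈ B, f w < b := by simpa only [iInf_lt_iff, exists_prop] using hb
    filter_upwards [hBA w hw b hwb] with n ⟨z, hz, hzb⟩
    exact (iInf₂_le z hz).trans_lt hzb

lemma setLimsup_minimizers_subset [LinearOrder β] [DenselyOrdered β] {f : Z → β}
    (hf : LowerSemicontinuous f) (hAB : setLimsup A ⊆ B)
    (hBA : ∀ w ∈ B, ∀ b > f w, ∀ᶠ n in atTop, ∃ z ∈ A n, f z < b) :
    setLimsup (fun n => {z | z ∈ A n ∧ ∀ v ∈ A n, f z ≤ f v}) ⊆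
      {z | z ∈ B ∧ ∀ v ∈ B, f z ≤ f v} := by
  intro w hw
  obtain ⟨l, _, hfst, hsnd, hmin⟩ := exists_filter_of_mem_setLimsup hw
  refine ⟨hAB (mapsTo_setLimsup continuous_id (fun _ _ hz => hz.1) hw), fun v hv => ?_⟩
  by_contra! hvw
  obtain ⟨b, hvb, hbw⟩ := exists_between hvw
  obtain ⟨p, hbp, hp, y, hy, hyb⟩ := ((hsnd.eventually (hf w b hbw)).and
    (hmin.and (hfst.eventually (hBA v hv b hvb)))).exists
  exact (hbp.trans_le (hp.2 y hy)).not_gt hyb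

end Minimization

section Program

variable {S : Type*} [Fintype S] {Cn : ℕ → Set (Matrix S S ℝ)} {C : Set (Matrix S S ℝ)}

lemma setLimsup_feasible_subset (h : setLimsup Cn ⊆ C) :
    setLimsup (fun n => feasible (Cn n)) ⊆ feasible C := by
  have hclosed : IsClosed {z : (S → ℝ) × Matrix S S ℝ | z.1 ∈ stdSimplex ℝ S ∧
      Matrix.vecMul z.1 z.2 = z.1} :=
    ((isClosed_stdSimplex ℝ S).preimage continuous_fst).inter
      (isClosed_eq (continuous_fst.matrix_vecMul continuous_snd) continuous_fst)
  intro w hw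
  have hw' := setLimsup_subset_of_isClosed hclosed (fun _ _ hz => ⟨hz.1, hz.2.2⟩) hw
  exact ⟨hw'.1, h (mapsTo_setLimsup continuous_snd (fun _ _ hz => hz.2.1) hw), hw'.2⟩

lemma isCompact_setOf_rows_mem_stdSimplex :
    IsCompact {R : Matrix S S ℝ | ∀ s, R s ∈ stdSimplex ℝ S} :=
  isCompact_pi_infinite fun _ => isCompact_stdSimplex ℝ S

lemma tendsto_optimalValue (c : S → ℝ) (hCn : ∀ n, ∀ R ∈ Cn n, ∀ s, R s ∈ stdSimplex ℝ S)
    (hout : setLimsup Cn ⊆ C)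
    (hin : ∀ w ∈ feasible C, ∀ U ∈ 𝓝 w.1, ∀ᶠ n in atTop, ∃ z ∈ feasible (Cn n), z.1 ∈ U) :
    Tendsto (fun n => optimalValue c (Cn n)) atTop (𝓝 (optimalValue c C)) := by
  have hcont : Continuous fun lam : S → ℝ => ((c ⬝ᵥ lam : ℝ) : EReal) :=
    continuous_coe_real_ereal.comp (continuous_const.dotProduct continuous_id)
  exact tendsto_iInf_of_setLimsup_subset (hcont.comp continuous_fst).lowerSemicontinuous
    ((isCompact_stdSimplex ℝ S).prod isCompact_setOf_rows_mem_stdSimplex)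
    (fun n z hz => ⟨hz.1, hCn n z.2 hz.2.1⟩) (setLimsup_feasible_subset hout)
    fun w hw b hb => hin w hw {lam | ((c ⬝ᵥ lam : ℝ) : EReal) < b}
      (hcont.tendsto w.1 (Iio_mem_nhds hb))

lemma setLimsup_optimalSolutions_subset (c : S → ℝ) (hout : setLimsup Cn ⊆ C)
    (hin : ∀ w ∈ feasible C, ∀ U ∈ 𝓝 w.1, ∀ᶠ n in atTop, ∃ z ∈ feasible (Cn n), z.1 ∈ U) :
    setLimsup (fun n => optimalSolutions c (Cn n)) ⊆ optimalSolutions c C := by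
  have hcont : Continuous fun lam : S → ℝ => c ⬝ᵥ lam :=
    continuous_const.dotProduct continuous_id
  exact setLimsup_minimizers_subset (hcont.comp continuous_fst).lowerSemicontinuous
    (setLimsup_feasible_subset hout)
    fun w hw b hb => hin w hw {lam | c ⬝ᵥ lam < b} (hcont.tendsto w.1 (Iio_mem_nhds hb))

end Program

lemma exists_fixedPoint_of_isCompact_of_convex {E : Type*} [NormedAddCommGroup E]
    [NormedSpace ℝ E] {K : Set E} (hK : IsCompact K) (hconv : Convex ℝ K) (hne : K.Nonempty)
    (T : E →L[ℝ] E) (hT : Set.MapsTo T K K) : ∃ x ∈ K, T x = x := by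
  obtain ⟨x₀, hx₀⟩ := hne
  have horbit : ∀ i, T^[i] x₀ ∈ K := fun i => hT.iterate i hx₀
  have hmem : ∀ n, birkhoffAverage ℝ T id (n + 1) x₀ ∈ K := fun n => by
    rw [birkhoffAverage, birkhoffSum, Finset.smul_sum]
    refine hconv.sum_mem (fun i _ => by positivity) ?_ fun i _ => horbit i
    rw [Finset.sum_const, Finset.card_range, nsmul_eq_mul,
      mul_inv_cancel₀ (Nat.cast_ne_zero.2 n.succ_ne_zero)]
  have hshift : ∀ n, T (birkhoffAverage ℝ T id n x₀) = birkhoffAverage ℝ T id n (T x₀) :=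
    fun n => by
      rw [map_birkhoffAverage ℝ ℝ]
      simp only [birkhoffAverage, birkhoffSum, Function.comp_apply, id,
        ← Function.iterate_succ_apply', ← Function.iterate_succ_apply]
  have hsub : Tendsto (fun n => T (birkhoffAverage ℝ T id n x₀) - birkhoffAverage ℝ T id n x₀)
      atTop (𝓝 0) := by
    simp only [hshift]
    exact tendsto_birkhoffAverage_apply_sub_birkhoffAverage ℝ
      (hK.isBounded.subset (Set.range_subset_iff.2 horbit))
  obtain ⟨x, hx, φ, hφ, hlim⟩ := hK.tendsto_subseq hmem
  exact ⟨x, hx, sub_eq_zero.1 (tendsto_nhds_unique (((T.continuous.tendsto x).comp hlim).sub hlim)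
    (hsub.comp ((tendsto_add_atTop_nat 1).comp hφ.tendsto_atTop)))⟩

section Stationary

open Matrix

variable {S : Type*} [Fintype S] {R : Matrix S S ℝ} {lam ν g : S → ℝ}

lemma vecMul_mem_stdSimplex (hR : ∀ s, R s ∈ stdSimplex ℝ S) (hν : ν ∈ stdSimplex ℝ S) :
    ν ᵥ* R ∈ stdSimplex ℝ S := by
  rw [vecMul_eq_sum]
  exact (convex_stdSimplex ℝ S).sum_mem (fun i _ => hν.1 i) hν.2 fun i _ => hR i

/-- The probability vectors giving the same expectation as `lam` to every harmonic function
of `R`. -/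
def harmonicClass (R : Matrix S S ℝ) (lam : S → ℝ) : Set (S → ℝ) :=
  {ν | ν ∈ stdSimplex ℝ S ∧ ∀ h : S → ℝ, R *ᵥ h = h → ν ⬝ᵥ h = lam ⬝ᵥ h}

lemma isCompact_harmonicClass (R : Matrix S S ℝ) (lam : S → ℝ) :
    IsCompact (harmonicClass R lam) := by
  have hclosed : IsClosed {ν : S → ℝ | ∀ h, R *ᵥ h = h → ν ⬝ᵥ h = lam ⬝ᵥ h} := by
    simp only [Set.ofPred_forall]
    exact isClosed_iInter fun h => isClosed_iInter fun _ =>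
      isClosed_eq (continuous_id.dotProduct continuous_const) continuous_const
  exact (isCompact_stdSimplex ℝ S).inter_right hclosed

lemma convex_harmonicClass (R : Matrix S S ℝ) (lam : S → ℝ) : Convex ℝ (harmonicClass R lam) :=
  fun u hu v hv a b ha hb hab => ⟨convex_stdSimplex ℝ S hu.1 hv.1 ha hb hab, fun h hh => by
    rw [add_dotProduct, smul_dotProduct, smul_dotProduct, hu.2 h hh, hv.2 h hh, ← add_smul, hab,
      one_smul]⟩

lemma mapsTo_vecMul_harmonicClass (hR : ∀ s, R s ∈ stdSimplex ℝ S) (lam : S → ℝ) :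
    Set.MapsTo (fun ν => ν ᵥ* R) (harmonicClass R lam) (harmonicClass R lam) :=
  fun ν hν => ⟨vecMul_mem_stdSimplex hR hν.1, fun h hh => by
    rw [← dotProduct_mulVec, hh, hν.2 h hh]⟩

lemma exists_stationary_mem_harmonicClass (hR : ∀ s, R s ∈ stdSimplex ℝ S)
    (hlam : lam ∈ stdSimplex ℝ S) : ∃ ν ∈ harmonicClass R lam, ν ᵥ* R = ν :=
  exists_fixedPoint_of_isCompact_of_convex (isCompact_harmonicClass R lam)
    (convex_harmonicClass R lam) ⟨lam, hlam, fun _ _ => rfl⟩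
    (LinearMap.toContinuousLinearMap (vecMulLinear R)) (mapsTo_vecMul_harmonicClass hR lam)

lemma sum_mul_sq_sub_eq_zero_of_stationary (hR : ∀ s, R s ∈ stdSimplex ℝ S)
    (hlam : lam ᵥ* R = lam) (hg : (lam * g) ᵥ* R = lam * g) :
    ∑ s, ∑ t, lam s * R s t * (g s - g t) ^ 2 = 0 := by
  have hsource : ∑ s, ∑ t, lam s * R s t * g s ^ 2 = ∑ s, lam s * g s ^ 2 :=
    Finset.sum_congr rfl fun s _ => by
      rw [← Finset.sum_mul, ← Finset.mul_sum, (hR s).2, mul_one]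
  have htarget : ∑ s, ∑ t, lam s * R s t * g t ^ 2 = ∑ t, lam t * g t ^ 2 := by
    rw [Finset.sum_comm]
    refine Finset.sum_congr rfl fun t _ => ?_
    rw [← Finset.sum_mul]
    exact congrArg (· * g t ^ 2) (congrFun hlam t)
  have hcross : ∑ s, ∑ t, lam s * g s * R s t * g t = ∑ t, lam t * g t ^ 2 := by
    rw [Finset.sum_comm]
    refine Finset.sum_congr rfl fun t _ => ?_
    rw [← Finset.sum_mul, sq, ← mul_assoc]
    exact congrArg (· * g t) (congrFun hg t)
  have hexpand : ∀ s t, lam s * R s t * (g s - g t) ^ 2 = lam s * R s t * g s ^ 2 +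
      lam s * R s t * g t ^ 2 - 2 * (lam s * g s * R s t * g t) := fun s t => by ring
  simp only [hexpand, Finset.sum_sub_distrib, Finset.sum_add_distrib, ← Finset.mul_sum, hsource,
    htarget, hcross]
  ring

lemma eq_of_stationary_of_ne_zero (hR : ∀ s, R s ∈ stdSimplex ℝ S) (hpos : ∀ s, 0 < lam s)
    (hlam : lam ᵥ* R = lam) (hg : (lam * g) ᵥ* R = lam * g) {s t : S} (hst : R s t ≠ 0) :
    g s = g t := by
  have hnonneg : ∀ s t, 0 ≤ lam s * R s t * (g s - g t) ^ 2 := fun s t =>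
    mul_nonneg (mul_nonneg (hpos s).le ((hR s).1 t)) (sq_nonneg _)
  have hrow := (Fintype.sum_eq_zero_iff_of_nonneg fun s => Finset.sum_nonneg fun t _ =>
    hnonneg s t).1 (sum_mul_sq_sub_eq_zero_of_stationary hR hlam hg)
  have hterm := congrFun ((Fintype.sum_eq_zero_iff_of_nonneg (hnonneg s)).1 (congrFun hrow s)) t
  exact sub_eq_zero.1 (pow_eq_zero_iff two_ne_zero |>.1
    ((mul_eq_zero.1 hterm).resolve_left (mul_ne_zero (hpos s).ne' hst)))

lemma mulVec_eq_self_of_forall_ne_zero (hR : ∀ s, R s ∈ stdSimplex ℝ S)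
    (hg : ∀ s t, R s t ≠ 0 → g s = g t) : R *ᵥ g = g := by
  ext s
  have hconst : ∀ t, R s t * g t = R s t * g s := fun t => by
    by_cases hst : R s t = 0
    · rw [hst, zero_mul, zero_mul]
    · rw [hg s t hst]
  rw [mulVec, dotProduct, Finset.sum_congr rfl fun t _ => hconst t, ← Finset.sum_mul, (hR s).2,
    one_mul]

lemma eq_one_of_dotProduct_eq (hpos : ∀ s, 0 < lam s) (hlam : lam ∈ stdSimplex ℝ S)
    (hg : lam * g ∈ stdSimplex ℝ S) (h : (lam * g) ⬝ᵥ g = lam ⬝ᵥ g) : g = 1 := by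
  have hmean : ∑ s, lam s * g s = 1 := hg.2
  have hmoment : ∑ s, lam s * g s * g s = 1 := h.trans hmean
  have hvar : ∑ s, lam s * (g s - 1) ^ 2 = 0 := by
    have hexpand : ∀ s, lam s * (g s - 1) ^ 2 =
      lam s * g s * g s - 2 * (lam s * g s) + lam s := fun s => by ring
    simp only [hexpand, Finset.sum_add_distrib, Finset.sum_sub_distrib, ← Finset.mul_sum, hmoment,
      hmean, hlam.2]
    norm_num
  have hterm := (Fintype.sum_eq_zero_iff_of_nonneg fun s =>
    mul_nonneg (hpos s).le (sq_nonneg (g s - 1))).1 hvar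
  ext s
  exact sub_eq_zero.1 (pow_eq_zero_iff two_ne_zero |>.1
    ((mul_eq_zero.1 (congrFun hterm s)).resolve_left (hpos s).ne'))

lemma setLimsup_stationary_harmonicClass_subset {Rn : ℕ → Matrix S S ℝ}
    (hlim : Tendsto Rn atTop (𝓝 R)) (hRn : ∀ᶠ n in atTop, ∀ s, Rn n s ∈ stdSimplex ℝ S)
    (hsupp : ∀ᶠ n in atTop, ∀ s t, R s t = 0 → Rn n s t = 0) (hmem : lam ∈ stdSimplex ℝ S)
    (hpos : ∀ s, 0 < lam s) (hlam : lam ᵥ* R = lam) :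
    setLimsup (fun n => {ν | ν ∈ harmonicClass (Rn n) lam ∧ ν ᵥ* Rn n = ν}) ⊆ {lam} := by
  intro w hw
  have hR : ∀ s, R s ∈ stdSimplex ℝ S := fun s => (isClosed_stdSimplex ℝ S).mem_of_tendsto
    (tendsto_pi_nhds.1 hlim s) (hRn.mono fun n hn => hn s)
  have hw_mem : w ∈ stdSimplex ℝ S :=
    setLimsup_subset_of_isClosed (isClosed_stdSimplex ℝ S) (fun _ _ hν => hν.1.1) hw
  obtain ⟨l, _, hfst, hsnd, hA⟩ := exists_filter_of_mem_setLimsup hw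
  obtain ⟨g, rfl⟩ : ∃ g, lam * g = w :=
    ⟨w / lam, funext fun s => mul_div_cancel₀ (w s) (hpos s).ne'⟩
  have hw_stat : (lam * g) ᵥ* R = lam * g :=
    tendsto_nhds_unique_of_eventuallyEq
      (((continuous_fst.matrix_vecMul continuous_snd).tendsto (lam * g, R)).comp
        (hsnd.prodMk_nhds (hlim.comp hfst))) hsnd (hA.mono fun p hp => hp.2)
  have hharm : ∀ᶠ p in l, p.2 ⬝ᵥ g = lam ⬝ᵥ g := by
    filter_upwards [hA, hfst.eventually hRn, hfst.eventually hsupp] with p hp hstoch hp_supp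
    exact hp.1.2 g (mulVec_eq_self_of_forall_ne_zero hstoch fun s t hst =>
      eq_of_stationary_of_ne_zero hR hpos hlam hw_stat (mt (hp_supp s t) hst))
  have hdot : (lam * g) ⬝ᵥ g = lam ⬝ᵥ g :=
    tendsto_nhds_unique_of_eventuallyEq
      (((continuous_id.dotProduct continuous_const).tendsto (lam * g)).comp hsnd)
      tendsto_const_nhds hharm
  rw [eq_one_of_dotProduct_eq hpos hmem hw_mem hdot, mul_one, Set.mem_singleton_iff]

lemma eventually_exists_stationary_mem_nhds {Rn : ℕ → Matrix S S ℝ}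
    (hlim : Tendsto Rn atTop (𝓝 R)) (hRn : ∀ᶠ n in atTop, ∀ s, Rn n s ∈ stdSimplex ℝ S)
    (hsupp : ∀ᶠ n in atTop, ∀ s t, R s t = 0 → Rn n s t = 0) (hmem : lam ∈ stdSimplex ℝ S)
    (hpos : ∀ s, 0 < lam s) (hlam : lam ᵥ* R = lam) {U : Set (S → ℝ)} (hU : U ∈ 𝓝 lam) :
    ∀ᶠ n in atTop, ∃ ν ∈ U, ν ∈ stdSimplex ℝ S ∧ ν ᵥ* Rn n = ν := by
  have hlimsup := setLimsup_stationary_harmonicClass_subset hlim hRn hsupp hmem hpos hlam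
  filter_upwards [hRn, eventually_subset_of_setLimsup_subset (isCompact_stdSimplex ℝ S)
    (fun _ _ hν => hν.1.1) isOpen_interior
    (hlimsup.trans (Set.singleton_subset_iff.2 (mem_interior_iff_mem_nhds.2 hU)))] with n hn hnU
  obtain ⟨ν, hν, hstat⟩ := exists_stationary_mem_harmonicClass hn hmem
  exact ⟨ν, interior_subset (hnU ⟨hν, hstat⟩), hν.1, hstat⟩

end Stationary

section Divergence

variable {S : Type*} [Fintype S] {u v : S → ℝ}

lemma klVec_of_support (h : ∀ s, v s = 0 → u s = 0) :
    klVec u v = ((∑ s, u s * Real.log (u s / v s) : ℝ) : EReal) :=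
  if_pos h

lemma mul_log_div_eq {a b : ℝ} (hb : b ≠ 0) :
    a * Real.log (a / b) = b * (a / b * Real.log (a / b)) := by
  rw [← mul_assoc, mul_div_cancel₀ _ hb]

omit [Fintype S] in
lemma eq_zero_of_tendsto_of_support {ι : Type*} {l : Filter ι} [l.NeBot] {un : ι → S → ℝ}
    (hu : Tendsto un l (𝓝 u)) (hsupp : ∀ᶠ i in l, ∀ s, v s = 0 → un i s = 0) {s : S}
    (hs : v s = 0) : u s = 0 :=
  tendsto_nhds_unique_of_eventuallyEq (tendsto_pi_nhds.1 hu s) tendsto_const_nhds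
    (hsupp.mono fun _ hi => hi s hs)

lemma tendsto_sum_mul_log_div {ι : Type*} {l : Filter ι} [l.NeBot] {un vn : ι → S → ℝ}
    (hu : Tendsto un l (𝓝 u)) (hv : Tendsto vn l (𝓝 v))
    (hsupp : ∀ᶠ i in l, ∀ s, v s = 0 → un i s = 0) :
    Tendsto (fun i => ∑ s, un i s * Real.log (un i s / vn i s)) l
      (𝓝 (∑ s, u s * Real.log (u s / v s))) := by
  refine tendsto_finsetSum _ fun s _ => ?_
  have hvs := tendsto_pi_nhds.1 hv s
  by_cases h : v s = 0
  · rw [eq_zero_of_tendsto_of_support hu hsupp h, zero_mul]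
    refine tendsto_const_nhds.congr' (hsupp.mono fun i hi => ?_)
    simp only [hi s h, zero_mul]
  · rw [mul_log_div_eq h]
    refine (hvs.mul ((Real.continuous_mul_log.tendsto _).comp
      ((tendsto_pi_nhds.1 hu s).div hvs h))).congr' ?_
    exact (hvs.eventually_ne h).mono fun i hi => (mul_log_div_eq hi).symm

lemma tendsto_klVec {ι : Type*} {l : Filter ι} [l.NeBot] {un vn : ι → S → ℝ}
    (hu : Tendsto un l (𝓝 u)) (hv : Tendsto vn l (𝓝 v))
    (hsupp : ∀ᶠ i in l, ∀ s, v s = 0 → un i s = 0) :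
    Tendsto (fun i => klVec (un i) (vn i)) l (𝓝 (klVec u v)) := by
  rw [klVec_of_support fun s => eq_zero_of_tendsto_of_support hu hsupp]
  refine (EReal.tendsto_coe.2 (tendsto_sum_mul_log_div hu hv hsupp)).congr' ?_
  have hne : ∀ᶠ i in l, ∀ s, v s ≠ 0 → vn i s ≠ 0 :=
    eventually_all.2 fun s => eventually_imp_distrib_left.2 fun hs =>
      (tendsto_pi_nhds.1 hv s).eventually_ne hs
  filter_upwards [hsupp, hne] with i hi hi_ne
  exact (klVec_of_support fun s hs => hi s (not_imp_not.1 (hi_ne s) hs)).symm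

lemma sum_mul_log_div_mix_le (hu : ∀ s, 0 ≤ u s) (hv : ∀ s, 0 ≤ v s)
    (huv : ∀ s, v s = 0 → u s = 0) {θ : ℝ} (hθ : θ ∈ Set.Icc (0 : ℝ) 1) :
    ∑ s, ((1 - θ) • u + θ • v) s * Real.log (((1 - θ) • u + θ • v) s / v s) ≤
      (1 - θ) * ∑ s, u s * Real.log (u s / v s) := by
  rw [Finset.mul_sum]
  refine Finset.sum_le_sum fun s _ => ?_
  simp only [Pi.add_apply, Pi.smul_apply, smul_eq_mul]
  by_cases h : v s = 0
  · simp [h, huv s h]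
  · have hmix : ((1 - θ) * u s + θ * v s) / v s = (1 - θ) * (u s / v s) + θ := by field_simp
    have hconv := Real.convexOn_mul_log.2 (x := u s / v s) (y := 1) (div_nonneg (hu s) (hv s))
      (Set.mem_Ici.2 zero_le_one) (sub_nonneg.2 hθ.2) hθ.1 (sub_add_cancel 1 θ)
    simp only [smul_eq_mul, Real.log_one, mul_zero, add_zero, mul_one] at hconv
    rw [mul_log_div_eq h, mul_log_div_eq h, hmix, mul_left_comm (1 - θ)]
    exact mul_le_mul_of_nonneg_left hconv (hv s)

lemma coe_mul_lt_of_coe_le {a b : ℝ} {τ : EReal} (hτ : 0 < τ) (ha : (a : EReal) ≤ τ)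
    (hb : b ∈ Set.Ico (0 : ℝ) 1) : ((b * a : ℝ) : EReal) < τ := by
  induction τ with
  | bot => exact absurd hτ not_lt_bot
  | top => exact EReal.coe_lt_top _
  | coe t =>
    have ht : 0 < t := EReal.coe_pos.1 hτ
    have hat : a ≤ t := EReal.coe_le_coe_iff.1 ha
    exact EReal.coe_lt_coe_iff.2 (by nlinarith [hb.1, hb.2])

lemma klVec_mix_lt (hu : ∀ s, 0 ≤ u s) (hv : ∀ s, 0 ≤ v s) (huv : ∀ s, v s = 0 → u s = 0)
    {θ : ℝ} (hθ : θ ∈ Set.Ioc (0 : ℝ) 1) {τ : EReal} (hτ : 0 < τ) (hkl : klVec u v ≤ τ) :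
    klVec ((1 - θ) • u + θ • v) v < τ := by
  rw [klVec_of_support fun s hs => by
    rw [Pi.add_apply, Pi.smul_apply, Pi.smul_apply, huv s hs, hs, smul_zero, smul_zero, add_zero]]
  rw [klVec_of_support huv] at hkl
  exact (EReal.coe_le_coe_iff.2 (sum_mul_log_div_mix_le hu hv huv ⟨hθ.1.le, hθ.2⟩)).trans_lt
    (coe_mul_lt_of_coe_le hτ hkl ⟨sub_nonneg.2 hθ.2, sub_lt_self 1 hθ.1⟩)

end Divergence

section Coupling

variable {𝒳 𝒴 : Type*} [Fintype 𝒳] [Fintype 𝒴] {u u' : 𝒳 → ℝ} {v v' : 𝒴 → ℝ}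
  {r : 𝒳 × 𝒴 → ℝ}

lemma mem_couplings_of_nonneg (hu : u ∈ stdSimplex ℝ 𝒳) (hr : ∀ p, 0 ≤ r p)
    (hfst : ∀ x, ∑ y, r (x, y) = u x) (hsnd : ∀ y, ∑ x, r (x, y) = v y) :
    r ∈ couplings u v :=
  ⟨⟨hr, by simp only [Fintype.sum_prod_type, hfst, hu.2]⟩, hfst, hsnd⟩

lemma fst_mem_stdSimplex_of_mem_couplings (hr : r ∈ couplings u v) : u ∈ stdSimplex ℝ 𝒳 := by
  refine ⟨fun x => hr.2.1 x ▸ Finset.sum_nonneg fun y _ => hr.1.1 _, ?_⟩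
  simp only [← hr.2.1, ← Fintype.sum_prod_type, hr.1.2]

lemma snd_mem_stdSimplex_of_mem_couplings (hr : r ∈ couplings u v) : v ∈ stdSimplex ℝ 𝒴 := by
  refine ⟨fun y => hr.2.2 y ▸ Finset.sum_nonneg fun x _ => hr.1.1 _, ?_⟩
  simp only [← hr.2.2, ← Fintype.sum_prod_type_right, hr.1.2]

lemma eq_zero_of_mem_couplings (hr : r ∈ couplings u v) {p : 𝒳 × 𝒴} (h : u p.1 * v p.2 = 0) :
    r p = 0 := by
  refine le_antisymm ?_ (hr.1.1 p)
  rcases mul_eq_zero.1 h with h | h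
  · rw [← h, ← hr.2.1 p.1]
    exact Finset.single_le_sum (f := fun y => r (p.1, y)) (fun y _ => hr.1.1 _)
      (Finset.mem_univ p.2)
  · rw [← h, ← hr.2.2 p.2]
    exact Finset.single_le_sum (f := fun x => r (x, p.2)) (fun x _ => hr.1.1 _)
      (Finset.mem_univ p.1)

lemma product_mem_couplings (hu : u ∈ stdSimplex ℝ 𝒳) (hv : v ∈ stdSimplex ℝ 𝒴) :
    (fun p : 𝒳 × 𝒴 => u p.1 * v p.2) ∈ couplings u v :=
  mem_couplings_of_nonneg hu (fun p => mul_nonneg (hu.1 _) (hv.1 _))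
    (fun x => by simp only [← Finset.mul_sum, hv.2, mul_one])
    (fun y => by simp only [← Finset.sum_mul, hu.2, one_mul])

lemma convex_couplings (u : 𝒳 → ℝ) (v : 𝒴 → ℝ) : Convex ℝ (couplings u v) := by
  refine fun r hr r' hr' a b ha hb hab =>
    ⟨convex_stdSimplex ℝ _ hr.1 hr'.1 ha hb hab, fun x => ?_, fun y => ?_⟩ <;>
  simp only [Pi.add_apply, Pi.smul_apply, smul_eq_mul, Finset.sum_add_distrib, ← Finset.mul_sum,
    hr.2.1, hr'.2.1, hr.2.2, hr'.2.2, ← add_mul, hab, one_mul]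

lemma mem_couplings_of_tendsto {ι : Type*} {l : Filter ι} [l.NeBot] {un : ι → 𝒳 → ℝ}
    {vn : ι → 𝒴 → ℝ} {rn : ι → 𝒳 × 𝒴 → ℝ} (hu : Tendsto un l (𝓝 u)) (hv : Tendsto vn l (𝓝 v))
    (hr : Tendsto rn l (𝓝 r)) (h : ∀ᶠ i in l, rn i ∈ couplings (un i) (vn i)) :
    r ∈ couplings u v := by
  have hr_apply := tendsto_pi_nhds.1 hr
  refine ⟨(isClosed_stdSimplex ℝ _).mem_of_tendsto hr (h.mono fun i hi => hi.1),
    fun x => ?_, fun y => ?_⟩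
  · exact tendsto_nhds_unique_of_eventuallyEq (tendsto_finsetSum _ fun y _ => hr_apply (x, y))
      (tendsto_pi_nhds.1 hu x) (h.mono fun i hi => hi.2.1 x)
  · exact tendsto_nhds_unique_of_eventuallyEq (tendsto_finsetSum _ fun x _ => hr_apply (x, y))
      (tendsto_pi_nhds.1 hv y) (h.mono fun i hi => hi.2.2 y)

/-- The correction of a vector `r` with marginals `u` and `v` to the marginals `u'` and `v'`. It
adds the signed vectors `(u' - u) ⊗ v` and `u ⊗ (v' - v)`, so the result may have negative
entries. -/
def adjustMarginals (u u' : 𝒳 → ℝ) (v v' : 𝒴 → ℝ) (r : 𝒳 × 𝒴 → ℝ) : 𝒳 × 𝒴 → ℝ :=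
  fun p => r p + (u' p.1 - u p.1) * v p.2 + u p.1 * (v' p.2 - v p.2)

lemma adjustMarginals_mem_couplings (hr : r ∈ couplings u v) (hu' : u' ∈ stdSimplex ℝ 𝒳)
    (hv' : v' ∈ stdSimplex ℝ 𝒴) (hnonneg : ∀ p, 0 ≤ adjustMarginals u u' v v' r p) :
    adjustMarginals u u' v v' r ∈ couplings u' v' := by
  refine mem_couplings_of_nonneg hu' hnonneg (fun x => ?_) (fun y => ?_)
  · simp only [adjustMarginals, Finset.sum_add_distrib, ← Finset.mul_sum, Finset.sum_sub_distrib,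
      hr.2.1, (snd_mem_stdSimplex_of_mem_couplings hr).2, hv'.2]
    ring
  · simp only [adjustMarginals, Finset.sum_add_distrib, ← Finset.sum_mul, Finset.sum_sub_distrib,
      hr.2.2, (fst_mem_stdSimplex_of_mem_couplings hr).2, hu'.2]
    ring

lemma adjustMarginals_eq_zero (hr : r ∈ couplings u v) (hu : ∀ x, u x = 0 → u' x = 0)
    (hv : ∀ y, v y = 0 → v' y = 0) {p : 𝒳 × 𝒴} (h : u p.1 * v p.2 = 0) :
    adjustMarginals u u' v v' r p = 0 := by
  rw [adjustMarginals, eq_zero_of_mem_couplings hr h]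
  rcases mul_eq_zero.1 h with h | h
  · rw [h, hu _ h]
    ring
  · rw [h, hv _ h]
    ring

variable {ι : Type*} {l : Filter ι} {un : ι → 𝒳 → ℝ} {vn : ι → 𝒴 → ℝ}

omit [Fintype 𝒳] [Fintype 𝒴] in
lemma tendsto_adjustMarginals (hu : Tendsto un l (𝓝 u)) (hv : Tendsto vn l (𝓝 v))
    (r : 𝒳 × 𝒴 → ℝ) : Tendsto (fun i => adjustMarginals u (un i) v (vn i) r) l (𝓝 r) := by
  refine tendsto_pi_nhds.2 fun p => ?_
  have hleft := ((tendsto_pi_nhds.1 hu p.1).sub_const (u p.1)).mul_const (v p.2)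
  have hright := ((tendsto_pi_nhds.1 hv p.2).sub_const (v p.2)).const_mul (u p.1)
  simpa only [adjustMarginals, sub_self, zero_mul, mul_zero, add_zero] using
    (hleft.const_add (r p)).add hright

lemma eventually_adjustMarginals_mem_couplings (hu : Tendsto un l (𝓝 u))
    (hv : Tendsto vn l (𝓝 v)) (hun : ∀ᶠ i in l, un i ∈ stdSimplex ℝ 𝒳)
    (hvn : ∀ᶠ i in l, vn i ∈ stdSimplex ℝ 𝒴) (husupp : ∀ᶠ i in l, ∀ x, u x = 0 → un i x = 0)
    (hvsupp : ∀ᶠ i in l, ∀ y, v y = 0 → vn i y = 0) (hr : r ∈ couplings u v)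
    (hpos : ∀ p : 𝒳 × 𝒴, u p.1 * v p.2 ≠ 0 → 0 < r p) :
    ∀ᶠ i in l, adjustMarginals u (un i) v (vn i) r ∈ couplings (un i) (vn i) := by
  have hnonneg : ∀ᶠ i in l, ∀ p, 0 ≤ adjustMarginals u (un i) v (vn i) r p := by
    refine eventually_all.2 fun p => ?_
    by_cases h : u p.1 * v p.2 = 0
    · filter_upwards [husupp, hvsupp] with i hi_u hi_v
      exact (adjustMarginals_eq_zero hr hi_u hi_v h).ge
    · have hlim := tendsto_pi_nhds.1 (tendsto_adjustMarginals hu hv r) p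
      exact (hlim.eventually_const_lt (hpos p h)).mono fun _ => le_of_lt
  filter_upwards [hun, hvn, hnonneg] with i hi_u hi_v hi
  exact adjustMarginals_mem_couplings hr hi_u hi_v hi

end Coupling

section Mixture

open Matrix

variable {S : Type*} {ε : ℝ} {lam p : S → ℝ} {R I : Matrix S S ℝ}

/-- The conditional probability, given a state drawn from the mixture `(1 - ε) • lam + ε • p`, that
it was drawn from `p`. -/
noncomputable def posteriorWeight (ε : ℝ) (lam p : S → ℝ) (s : S) : ℝ :=
  ε * p s / ((1 - ε) • lam + ε • p) s

/-- The transition matrix that moves by `I` with the posterior probability of `p` and by `R`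
otherwise. It is chosen to preserve `(1 - ε) • lam + ε • p` if `R` preserves `lam` and `I`
preserves `p`. -/
noncomputable def mixtureTransition (ε : ℝ) (lam p : S → ℝ) (R I : Matrix S S ℝ) : Matrix S S ℝ :=
  fun s => (1 - posteriorWeight ε lam p s) • R s + posteriorWeight ε lam p s • I s

lemma mixture_pos (hε : ε ∈ Set.Ioc (0 : ℝ) 1) (hlam : ∀ s, 0 ≤ lam s) (hp : ∀ s, 0 < p s)
    (s : S) : 0 < ((1 - ε) • lam + ε • p) s :=
  add_pos_of_nonneg_of_pos (mul_nonneg (sub_nonneg.2 hε.2) (hlam s)) (mul_pos hε.1 (hp s))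

lemma posteriorWeight_mem_Ioc (hε : ε ∈ Set.Ioc (0 : ℝ) 1) (hlam : ∀ s, 0 ≤ lam s)
    (hp : ∀ s, 0 < p s) (s : S) : posteriorWeight ε lam p s ∈ Set.Ioc (0 : ℝ) 1 :=
  have hpos := mixture_pos hε hlam hp s
  ⟨div_pos (mul_pos hε.1 (hp s)) hpos, (div_le_one hpos).2
    (le_add_of_nonneg_left (mul_nonneg (sub_nonneg.2 hε.2) (hlam s)))⟩

lemma vecMul_mixtureTransition [Fintype S] (hε : ε ∈ Set.Ioc (0 : ℝ) 1) (hlam : ∀ s, 0 ≤ lam s)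
    (hp : ∀ s, 0 < p s) (hR : lam ᵥ* R = lam) (hI : p ᵥ* I = p) :
    ((1 - ε) • lam + ε • p) ᵥ* mixtureTransition ε lam p R I = (1 - ε) • lam + ε • p := by
  have hflow : ∀ s, ((1 - ε) • lam + ε • p) s • mixtureTransition ε lam p R I s =
      ((1 - ε) • lam) s • R s + (ε • p) s • I s := fun s => by
    have hweight : ((1 - ε) • lam + ε • p) s * posteriorWeight ε lam p s = (ε • p) s :=
      mul_div_cancel₀ _ (mixture_pos hε hlam hp s).ne'
    rw [mixtureTransition, smul_add, smul_smul, smul_smul, mul_sub, hweight, mul_one,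
      Pi.add_apply, add_sub_cancel_right]
  rw [vecMul_eq_sum, Finset.sum_congr rfl fun s _ => hflow s, Finset.sum_add_distrib,
    ← vecMul_eq_sum, ← vecMul_eq_sum, smul_vecMul, smul_vecMul, hR, hI]

end Mixture

section Stability

open Matrix

variable {𝒳 𝒴 : Type*} [Fintype 𝒳] [Fintype 𝒴] {P : Matrix 𝒳 𝒳 ℝ} {Q : Matrix 𝒴 𝒴 ℝ}
  {τ : EReal}

/-- The transition couplings with rows within divergence `τ` of those of `P ⊗ Q`. An extended real
`τ` treats the unconstrained couplings, `τ = ⊤`, together with the entropic ones. -/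
def klTransitionCouplings (τ : EReal) (P : Matrix 𝒳 𝒳 ℝ) (Q : Matrix 𝒴 𝒴 ℝ) :
    Set (Matrix (𝒳 × 𝒴) (𝒳 × 𝒴) ℝ) :=
  {R | R ∈ transitionCouplings P Q ∧ ∀ s, klVec (R s) (indep P Q s) ≤ τ}

lemma klTransitionCouplings_top (P : Matrix 𝒳 𝒳 ℝ) (Q : Matrix 𝒴 𝒴 ℝ) :
    klTransitionCouplings ⊤ P Q = transitionCouplings P Q :=
  Set.ext fun _ => and_iff_left fun _ => le_top

lemma stochastic_of_mem_feasible {w : (𝒳 × 𝒴 → ℝ) × Matrix (𝒳 × 𝒴) (𝒳 × 𝒴) ℝ}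
    (hw : w ∈ feasible (klTransitionCouplings τ P Q)) :
    (∀ x, P x ∈ stdSimplex ℝ 𝒳) ∧ ∀ y, Q y ∈ stdSimplex ℝ 𝒴 := by
  obtain ⟨x₀, y₀⟩ : Nonempty (𝒳 × 𝒴) := not_isEmpty_iff.1 fun _ =>
    Set.notMem_empty w.1 (stdSimplex_of_isEmpty_index ℝ (𝒳 × 𝒴) ▸ hw.1)
  exact ⟨fun x => fst_mem_stdSimplex_of_mem_couplings (hw.2.1.1 (x, y₀)),
    fun y => snd_mem_stdSimplex_of_mem_couplings (hw.2.1.1 (x₀, y))⟩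

lemma indep_row_mem_couplings (hP : ∀ x, P x ∈ stdSimplex ℝ 𝒳) (hQ : ∀ y, Q y ∈ stdSimplex ℝ 𝒴)
    (s : 𝒳 × 𝒴) : indep P Q s ∈ couplings (P s.1) (Q s.2) :=
  product_mem_couplings (hP s.1) (hQ s.2)

lemma product_vecMul_indep {m : 𝒳 → ℝ} {k : 𝒴 → ℝ} (hm : m ᵥ* P = m) (hk : k ᵥ* Q = k) :
    (fun s : 𝒳 × 𝒴 => m s.1 * k s.2) ᵥ* indep P Q = fun s => m s.1 * k s.2 := by
  ext t
  calc ∑ s : 𝒳 × 𝒴, m s.1 * k s.2 * (P s.1 t.1 * Q s.2 t.2)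
      = ∑ x, ∑ y, m x * P x t.1 * (k y * Q y t.2) := by
        simp only [Fintype.sum_prod_type, mul_mul_mul_comm]
    _ = (m ᵥ* P) t.1 * (k ᵥ* Q) t.2 := (Finset.sum_mul_sum _ _ _ _).symm
    _ = m t.1 * k t.2 := by rw [hm, hk]

/-- The feasible pairs at which every inequality constraint that can be strict is strict. -/
def strictlyFeasible (τ : EReal) (P : Matrix 𝒳 𝒳 ℝ) (Q : Matrix 𝒴 𝒴 ℝ) :
    Set ((𝒳 × 𝒴 → ℝ) × Matrix (𝒳 × 𝒴) (𝒳 × 𝒴) ℝ) :=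
  {z | z ∈ feasible (transitionCouplings P Q) ∧ (∀ s, 0 < z.1 s) ∧
    (∀ s t, indep P Q s t ≠ 0 → 0 < z.2 s t) ∧ ∀ s, klVec (z.2 s) (indep P Q s) < τ}

lemma mixture_mem_strictlyFeasible (hτ : 0 < τ) {lam p : 𝒳 × 𝒴 → ℝ}
    {R : Matrix (𝒳 × 𝒴) (𝒳 × 𝒴) ℝ} (hw : (lam, R) ∈ feasible (klTransitionCouplings τ P Q))
    (hp : p ∈ stdSimplex ℝ (𝒳 × 𝒴)) (hpos : ∀ s, 0 < p s) (hpI : p ᵥ* indep P Q = p) {ε : ℝ}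
    (hε : ε ∈ Set.Ioc (0 : ℝ) 1) :
    ((1 - ε) • lam + ε • p, mixtureTransition ε lam p R (indep P Q)) ∈
      strictlyFeasible τ P Q := by
  obtain ⟨hP, hQ⟩ := stochastic_of_mem_feasible hw
  obtain ⟨hlam, ⟨hR, hRτ⟩, hlamR⟩ := hw
  have hI := indep_row_mem_couplings hP hQ
  have hθ := posteriorWeight_mem_Ioc hε hlam.1 hpos
  refine ⟨⟨?_, fun s => ?_, vecMul_mixtureTransition hε hlam.1 hpos hlamR hpI⟩,
    mixture_pos hε hlam.1 hpos, fun s t hst => ?_, fun s => ?_⟩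
  · exact convex_stdSimplex ℝ _ hlam hp (sub_nonneg.2 hε.2) hε.1.le (sub_add_cancel 1 ε)
  · exact convex_couplings _ _ (hR s) (hI s) (sub_nonneg.2 (hθ s).2) (hθ s).1.le
      (sub_add_cancel 1 _)
  · exact add_pos_of_nonneg_of_pos (mul_nonneg (sub_nonneg.2 (hθ s).2) ((hR s).1.1 t))
      (mul_pos (hθ s).1 (((hI s).1.1 t).lt_of_ne' hst))
  · exact klVec_mix_lt (hR s).1.1 (hI s).1.1 (fun t => eq_zero_of_mem_couplings (hR s)) (hθ s) hτ
      (hRτ s)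

lemma fst_mem_closure_strictlyFeasible (hτ : 0 < τ)
    {w : (𝒳 × 𝒴 → ℝ) × Matrix (𝒳 × 𝒴) (𝒳 × 𝒴) ℝ}
    (hw : w ∈ feasible (klTransitionCouplings τ P Q)) {p : 𝒳 × 𝒴 → ℝ}
    (hp : p ∈ stdSimplex ℝ (𝒳 × 𝒴)) (hpos : ∀ s, 0 < p s) (hpI : p ᵥ* indep P Q = p) :
    w.1 ∈ closure (Prod.fst '' strictlyFeasible τ P Q) := by
  have hcont : Continuous fun ε : ℝ => (1 - ε) • w.1 + ε • p := by fun_prop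
  have hlim : Tendsto (fun ε : ℝ => (1 - ε) • w.1 + ε • p) (𝓝[>] 0) (𝓝 w.1) := by
    simpa only [sub_zero, one_smul, zero_smul, add_zero] using
      (hcont.tendsto 0).mono_left nhdsWithin_le_nhds
  refine mem_closure_of_tendsto hlim ?_
  filter_upwards [Ioc_mem_nhdsGT zero_lt_one] with ε hε
  exact ⟨_, mixture_mem_strictlyFeasible hτ hw hp hpos hpI hε, rfl⟩

/-- Approximation of `P` by the matrices `Pn n`, to the extent needed for the stability of optimal
transition couplings. Two of the properties are restricted to stochastic `P` because a one-step
matrix has a zero row at each state of probability zero. -/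
structure StochasticApprox (Pn : ℕ → Matrix 𝒳 𝒳 ℝ) (P : Matrix 𝒳 𝒳 ℝ) : Prop where
  tendsto : Tendsto Pn atTop (𝓝 P)
  eventually_support : ∀ᶠ n in atTop, ∀ x x', P x x' = 0 → Pn n x x' = 0
  eventually_stochastic : (∀ x, P x ∈ stdSimplex ℝ 𝒳) →
    ∀ᶠ n in atTop, ∀ x, Pn n x ∈ stdSimplex ℝ 𝒳
  exists_stationary : (∀ x, P x ∈ stdSimplex ℝ 𝒳) →
    ∃ m ∈ stdSimplex ℝ 𝒳, (∀ x, 0 < m x) ∧ m ᵥ* P = m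

lemma StochasticApprox.tendsto_row {Pn : ℕ → Matrix 𝒳 𝒳 ℝ} (h : StochasticApprox Pn P) (x : 𝒳) :
    Tendsto (fun n => Pn n x) atTop (𝓝 (P x)) :=
  tendsto_pi_nhds.1 h.tendsto x

variable {Pn : ℕ → Matrix 𝒳 𝒳 ℝ} {Qn : ℕ → Matrix 𝒴 𝒴 ℝ}

lemma tendsto_indep_row (hP : StochasticApprox Pn P) (hQ : StochasticApprox Qn Q) (s : 𝒳 × 𝒴) :
    Tendsto (fun n => indep (Pn n) (Qn n) s) atTop (𝓝 (indep P Q s)) :=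
  tendsto_pi_nhds.2 fun t => (tendsto_pi_nhds.1 (hP.tendsto_row s.1) t.1).mul
    (tendsto_pi_nhds.1 (hQ.tendsto_row s.2) t.2)

lemma eventually_transitionCouplings_eq_zero (hP : StochasticApprox Pn P)
    (hQ : StochasticApprox Qn Q) : ∀ᶠ n in atTop, ∀ R ∈ transitionCouplings (Pn n) (Qn n),
      ∀ s t, indep P Q s t = 0 → R s t = 0 := by
  filter_upwards [hP.eventually_support, hQ.eventually_support] with n hPn hQn R hR s t hst
  exact eq_zero_of_mem_couplings (hR s) (mul_eq_zero.2
    ((mul_eq_zero.1 hst).imp (hPn s.1 t.1) (hQn s.2 t.2)))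

lemma setLimsup_klTransitionCouplings_subset (τ : EReal) (hP : StochasticApprox Pn P)
    (hQ : StochasticApprox Qn Q) :
    setLimsup (fun n => klTransitionCouplings τ (Pn n) (Qn n)) ⊆ klTransitionCouplings τ P Q := by
  intro R hR
  obtain ⟨l, _, hfst, hsnd, hmem⟩ := exists_filter_of_mem_setLimsup hR
  have hrow := tendsto_pi_nhds.1 hsnd
  refine ⟨fun s => mem_couplings_of_tendsto ((hP.tendsto_row s.1).comp hfst)
    ((hQ.tendsto_row s.2).comp hfst) (hrow s) (hmem.mono fun p hp => hp.1 s), fun s => ?_⟩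
  have hsupp : ∀ᶠ p in l, ∀ t, indep P Q s t = 0 → p.2 s t = 0 := by
    filter_upwards [hmem, hfst.eventually (eventually_transitionCouplings_eq_zero hP hQ)]
      with p hp hzero
    exact hzero p.2 hp.1 s
  exact le_of_tendsto (tendsto_klVec (hrow s) ((tendsto_indep_row hP hQ s).comp hfst) hsupp)
    (hmem.mono fun p hp => hp.2 s)

lemma exists_tendsto_mem_klTransitionCouplings (hP : StochasticApprox Pn P)
    (hQ : StochasticApprox Qn Q) (hPs : ∀ x, P x ∈ stdSimplex ℝ 𝒳)
    (hQs : ∀ y, Q y ∈ stdSimplex ℝ 𝒴) {R : Matrix (𝒳 × 𝒴) (𝒳 × 𝒴) ℝ}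
    (hR : R ∈ transitionCouplings P Q) (hpos : ∀ s t, indep P Q s t ≠ 0 → 0 < R s t)
    (hkl : ∀ s, klVec (R s) (indep P Q s) < τ) :
    ∃ Rn : ℕ → Matrix (𝒳 × 𝒴) (𝒳 × 𝒴) ℝ, Tendsto Rn atTop (𝓝 R) ∧
      ∀ᶠ n in atTop, Rn n ∈ klTransitionCouplings τ (Pn n) (Qn n) := by
  let Rn (n : ℕ) : Matrix (𝒳 × 𝒴) (𝒳 × 𝒴) ℝ := fun s =>
    adjustMarginals (P s.1) (Pn n s.1) (Q s.2) (Qn n s.2) (R s)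
  have hlim : Tendsto Rn atTop (𝓝 R) := tendsto_pi_nhds.2 fun s =>
    tendsto_adjustMarginals (hP.tendsto_row s.1) (hQ.tendsto_row s.2) (R s)
  have hmem : ∀ᶠ n in atTop, Rn n ∈ transitionCouplings (Pn n) (Qn n) :=
    eventually_all.2 fun s =>
      eventually_adjustMarginals_mem_couplings (hP.tendsto_row s.1) (hQ.tendsto_row s.2)
        ((hP.eventually_stochastic hPs).mono fun _ hn => hn s.1)
        ((hQ.eventually_stochastic hQs).mono fun _ hn => hn s.2)
        (hP.eventually_support.mono fun _ hn => hn s.1)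
        (hQ.eventually_support.mono fun _ hn => hn s.2) (hR s) (hpos s)
  have hsupp : ∀ s, ∀ᶠ n in atTop, ∀ t, indep P Q s t = 0 → Rn n s t = 0 := fun s => by
    filter_upwards [hmem, eventually_transitionCouplings_eq_zero hP hQ] with n hn hzero
    exact hzero (Rn n) hn s
  have hkl_lt : ∀ᶠ n in atTop, ∀ s, klVec (Rn n s) (indep (Pn n) (Qn n) s) < τ :=
    eventually_all.2 fun s => (tendsto_klVec (tendsto_pi_nhds.1 hlim s)
      (tendsto_indep_row hP hQ s) (hsupp s)).eventually_lt_const (hkl s)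
  exact ⟨Rn, hlim, (hmem.and hkl_lt).mono fun n hn => ⟨hn.1, fun s => (hn.2 s).le⟩⟩

lemma eventually_exists_feasible_of_mem_strictlyFeasible (hP : StochasticApprox Pn P)
    (hQ : StochasticApprox Qn Q) (hPs : ∀ x, P x ∈ stdSimplex ℝ 𝒳)
    (hQs : ∀ y, Q y ∈ stdSimplex ℝ 𝒴) {z : (𝒳 × 𝒴 → ℝ) × Matrix (𝒳 × 𝒴) (𝒳 × 𝒴) ℝ}
    (hz : z ∈ strictlyFeasible τ P Q) {U : Set (𝒳 × 𝒴 → ℝ)} (hU : U ∈ 𝓝 z.1) :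
    ∀ᶠ n in atTop, ∃ z' ∈ feasible (klTransitionCouplings τ (Pn n) (Qn n)), z'.1 ∈ U := by
  obtain ⟨⟨hlam, hR, hstat⟩, hlam_pos, hR_pos, hkl⟩ := hz
  obtain ⟨Rn, hlim, hRn⟩ := exists_tendsto_mem_klTransitionCouplings hP hQ hPs hQs hR hR_pos hkl
  have hsupp : ∀ᶠ n in atTop, ∀ s t, z.2 s t = 0 → Rn n s t = 0 := by
    filter_upwards [hRn, eventually_transitionCouplings_eq_zero hP hQ] with n hn hzero s t hst
    exact hzero (Rn n) hn.1 s t (not_imp_not.1 (fun h => (hR_pos s t h).ne') hst)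
  filter_upwards [hRn, eventually_exists_stationary_mem_nhds hlim
    (hRn.mono fun n hn s => (hn.1 s).1) hsupp hlam hlam_pos hstat hU] with n hn ⟨ν, hνU, hν⟩
  exact ⟨(ν, Rn n), ⟨hν.1, hn, hν.2⟩, hνU⟩

lemma eventually_exists_feasible_mem_nhds (hτ : 0 < τ) (hP : StochasticApprox Pn P)
    (hQ : StochasticApprox Qn Q) {w : (𝒳 × 𝒴 → ℝ) × Matrix (𝒳 × 𝒴) (𝒳 × 𝒴) ℝ}
    (hw : w ∈ feasible (klTransitionCouplings τ P Q)) {U : Set (𝒳 × 𝒴 → ℝ)} (hU : U ∈ 𝓝 w.1) :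
    ∀ᶠ n in atTop, ∃ z ∈ feasible (klTransitionCouplings τ (Pn n) (Qn n)), z.1 ∈ U := by
  obtain ⟨hPs, hQs⟩ := stochastic_of_mem_feasible hw
  obtain ⟨m, hm, hm_pos, hmP⟩ := hP.exists_stationary hPs
  obtain ⟨k, hk, hk_pos, hkQ⟩ := hQ.exists_stationary hQs
  have hclosure := fst_mem_closure_strictlyFeasible hτ hw (product_mem_couplings hm hk).1
    (fun s => mul_pos (hm_pos s.1) (hk_pos s.2)) (product_vecMul_indep hmP hkQ)
  obtain ⟨_, hU_int, z, hz, rfl⟩ := mem_closure_iff.1 hclosure (interior U) isOpen_interior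
    (mem_interior_iff_mem_nhds.2 hU)
  exact eventually_exists_feasible_of_mem_strictlyFeasible hP hQ hPs hQs hz
    (mem_interior_iff_mem_nhds.1 hU_int)

theorem klTransitionCouplings_stability (c : 𝒳 × 𝒴 → ℝ) (hτ : 0 < τ)
    (hP : StochasticApprox Pn P) (hQ : StochasticApprox Qn Q) :
    Tendsto (fun n => optimalValue c (klTransitionCouplings τ (Pn n) (Qn n))) atTop
        (𝓝 (optimalValue c (klTransitionCouplings τ P Q))) ∧
      setLimsup (fun n => optimalSolutions c (klTransitionCouplings τ (Pn n) (Qn n))) ⊆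
        optimalSolutions c (klTransitionCouplings τ P Q) := by
  have hout := setLimsup_klTransitionCouplings_subset τ hP hQ
  have hin := fun w hw U hU => eventually_exists_feasible_mem_nhds (w := w) (U := U) hτ hP hQ hw hU
  exact ⟨tendsto_optimalValue c (fun _ _ hR s => (hR.1 s).1) hout hin,
    setLimsup_optimalSolutions_subset c hout hin⟩

end Stability

section Observations

open Matrix

variable {Ω 𝒳 : Type*}

lemma shift_iterate (u : ℕ → 𝒳) (i : ℕ) : shift^[i] u = fun j => u (i + j) := by
  induction i with
  | zero => simp only [Function.iterate_zero, id_eq, Nat.zero_add]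
  | succ i ih =>
    rw [Function.iterate_succ_apply', ih]
    exact funext fun j => congrArg u (by omega)

section Counting

variable [DecidableEq 𝒳]

lemma empiricalMatrix_eq_zero {u : ℕ → 𝒳} {x x' : 𝒳} (h : ∀ i, ¬(u i = x ∧ u (i + 1) = x'))
    (n : ℕ) : empiricalMatrix u n x x' = 0 := by
  rw [empiricalMatrix, Finset.filter_false_of_mem fun i _ => h i, Finset.card_empty, Nat.cast_zero,
    zero_div]

lemma sum_card_filter_transition [Fintype 𝒳] (u : ℕ → 𝒳) (s : Finset ℕ) (x : 𝒳) :
    ∑ x', (s.filter fun i => u i = x ∧ u (i + 1) = x').card = (s.filter fun i => u i = x).card := by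
  simp only [← Finset.filter_filter]
  exact (Finset.card_eq_sum_card_fiberwise fun _ _ => Finset.mem_coe.2 (Finset.mem_univ _)).symm

lemma empiricalMatrix_mem_stdSimplex [Fintype 𝒳] {u : ℕ → 𝒳} {n : ℕ} {x : 𝒳}
    (h : ((Finset.range (n - 1)).filter fun i => u i = x).card ≠ 0) :
    empiricalMatrix u n x ∈ stdSimplex ℝ 𝒳 := by
  refine ⟨fun x' => div_nonneg (Nat.cast_nonneg _) (Nat.cast_nonneg _), ?_⟩
  simp only [empiricalMatrix]
  rw [← Finset.sum_div, ← Nat.cast_sum, sum_card_filter_transition, div_self (Nat.cast_ne_zero.2 h)]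

end Counting

variable [MeasurableSpace Ω] {μ : Measure Ω} {X : ℕ → Ω → 𝒳}

section Marginal

variable [IsFiniteMeasure μ]

lemma oneStepMatrix_eq_zero_iff {x x' : 𝒳} :
    oneStepMatrix μ X x x' = 0 ↔ μ.real {ω | X 0 ω = x ∧ X 1 ω = x'} = 0 :=
  div_eq_zero_iff.trans <| or_iff_left_of_imp fun h =>
    measureReal_mono_null (fun _ hω => hω.1) h

variable [Fintype 𝒳] [MeasurableSpace 𝒳] [MeasurableSingletonClass 𝒳]

lemma sum_measureReal_eq_and {Z : Ω → 𝒳} (hZ : Measurable Z) (B : Set Ω) :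
    ∑ x, μ.real {ω | Z ω = x ∧ ω ∈ B} = μ.real B := by
  have hfiber (x : 𝒳) : MeasurableSet (Z ⁻¹' {x}) := hZ (measurableSet_singleton x)
  have h := sum_measureReal_preimage_singleton (μ := μ.restrict B) Finset.univ fun x _ => hfiber x
  rw [Finset.coe_univ, Set.preimage_univ, measureReal_restrict_apply_univ] at h
  exact (Finset.sum_congr rfl fun x _ => (measureReal_restrict_apply (hfiber x)).symm).trans h

lemma law_vecMul_oneStepMatrix (hX : Measurable (X 0)) :
    (fun x => μ.real {ω | X 0 ω = x}) ᵥ* oneStepMatrix μ X = fun x => μ.real {ω | X 1 ω = x} := by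
  ext x'
  have hjoint (x : 𝒳) : μ.real {ω | X 0 ω = x} * oneStepMatrix μ X x x' =
      μ.real {ω | X 0 ω = x ∧ X 1 ω = x'} :=
    mul_div_cancel_of_imp' fun h => measureReal_mono_null (fun _ hω => hω.1) h
  exact (Finset.sum_congr rfl fun x _ => hjoint x).trans (sum_measureReal_eq_and hX _)

end Marginal

lemma measureReal_ne_zero_of_oneStepMatrix_mem_stdSimplex [Fintype 𝒳] {x : 𝒳}
    (hx : oneStepMatrix μ X x ∈ stdSimplex ℝ 𝒳) : μ.real {ω | X 0 ω = x} ≠ 0 := fun h => by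
  have hsum := hx.2
  simp only [oneStepMatrix, h, div_zero, Finset.sum_const_zero, zero_ne_one] at hsum

section Stationary

variable [MeasurableSpace 𝒳]

lemma ae_forall_not_of_stationary (hXm : ∀ i, Measurable (X i)) [IsFiniteMeasure μ]
    (hX : StationaryErgodic μ X) {p : (ℕ → 𝒳) → Prop} (hp : MeasurableSet {u | p u})
    (h : μ.real {ω | p fun j => X j ω} = 0) : ∀ᵐ ω ∂μ, ∀ i, ¬p fun j => X (i + j) ω := by
  have hpath : AEMeasurable (fun ω i => X i ω) μ := (measurable_pi_lambda _ hXm).aemeasurable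
  have hnull : ∀ᵐ u ∂μ.map fun ω i => X i ω, ¬p u :=
    (ae_map_iff hpath hp.compl).2 <| measure_eq_zero_iff_ae_notMem.1 <|
      (measureReal_eq_zero_iff).1 h
  refine ae_all_iff.2 fun i => ?_
  have hi := ae_of_ae_map hpath
    ((hX.toMeasurePreserving.iterate i).quasiMeasurePreserving.ae hnull)
  simpa only [shift_iterate] using hi

lemma measurableSet_coord_eq [MeasurableSingletonClass 𝒳] (i : ℕ) (x : 𝒳) :
    MeasurableSet {u : ℕ → 𝒳 | u i = x} :=
  (measurable_pi_apply i : Measurable fun u : ℕ → 𝒳 => u i) (measurableSet_singleton x)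

lemma measurableSet_transition [MeasurableSingletonClass 𝒳] (x x' : 𝒳) :
    MeasurableSet {u : ℕ → 𝒳 | u 0 = x ∧ u 1 = x'} :=
  (measurableSet_coord_eq 0 x).inter (measurableSet_coord_eq 1 x')

lemma measureReal_one_eq [MeasurableSingletonClass 𝒳] (hXm : ∀ i, Measurable (X i))
    (hX : StationaryErgodic μ X) (x : 𝒳) :
    μ.real {ω | X 1 ω = x} = μ.real {ω | X 0 ω = x} := by
  have hpath : Measurable fun ω i => X i ω := measurable_pi_lambda _ hXm
  have hx := measurableSet_coord_eq 0 x
  have h := hX.toMeasurePreserving.measureReal_preimage hx.nullMeasurableSet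
  rwa [map_measureReal_apply hpath hx,
    map_measureReal_apply hpath (hX.toMeasurePreserving.measurable hx)] at h

variable [IsProbabilityMeasure μ]

lemma ae_tendsto_frequency (hXm : ∀ i, Measurable (X i)) (hX : StationaryErgodic μ X)
    {p : (ℕ → 𝒳) → Prop} [DecidablePred p] (hp : MeasurableSet {u | p u}) :
    ∀ᵐ ω ∂μ, Tendsto (fun n : ℕ =>
      (((Finset.range n).filter fun i => p fun j => X (i + j) ω).card : ℝ) / n) atTop
      (𝓝 (μ.real {ω | p fun j => X j ω})) := by
  have hpath : Measurable fun ω i => X i ω := measurable_pi_lambda _ hXm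
  have := Measure.isProbabilityMeasure_map (μ := μ) hpath.aemeasurable
  have h := ae_tendsto_birkhoffAverage hX (measurable_one.indicator hp)
    ((integrable_const (1 : ℝ)).indicator hp)
  filter_upwards [ae_of_ae_map hpath.aemeasurable h] with ω hω
  rw [integral_indicator_one hp, map_measureReal_apply hpath hp] at hω
  refine hω.congr fun n => ?_
  simp only [birkhoffAverage, birkhoffSum, shift_iterate, Set.indicator_apply, Set.mem_ofPred_eq,
    Pi.one_apply, Finset.sum_boole, smul_eq_mul, inv_mul_eq_div]

variable [DecidableEq 𝒳] [MeasurableSingletonClass 𝒳]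

lemma ae_tendsto_frequency_state (hXm : ∀ i, Measurable (X i)) (hX : StationaryErgodic μ X)
    (x : 𝒳) : ∀ᵐ ω ∂μ, Tendsto (fun n : ℕ =>
      (((Finset.range (n - 1)).filter fun i => X i ω = x).card : ℝ) / (n - 1 : ℕ)) atTop
      (𝓝 (μ.real {ω | X 0 ω = x})) :=
  (ae_tendsto_frequency hXm hX (measurableSet_coord_eq 0 x)).mono fun _ h =>
    h.comp (tendsto_sub_atTop_nat 1)

lemma ae_empiricalMatrix_eq_zero (hXm : ∀ i, Measurable (X i)) (hX : StationaryErgodic μ X)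
    {x x' : 𝒳} (h : oneStepMatrix μ X x x' = 0) :
    ∀ᵐ ω ∂μ, ∀ n, empiricalMatrix (fun i => X i ω) n x x' = 0 :=
  (ae_forall_not_of_stationary hXm hX (measurableSet_transition x x')
    (oneStepMatrix_eq_zero_iff.1 h)).mono fun _ hω => empiricalMatrix_eq_zero hω

lemma ae_tendsto_empiricalMatrix_apply (hXm : ∀ i, Measurable (X i))
    (hX : StationaryErgodic μ X) (x x' : 𝒳) :
    ∀ᵐ ω ∂μ, Tendsto (fun n => empiricalMatrix (fun i => X i ω) n x x') atTop
      (𝓝 (oneStepMatrix μ X x x')) := by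
  by_cases h : oneStepMatrix μ X x x' = 0
  · filter_upwards [ae_empiricalMatrix_eq_zero hXm hX h] with ω hω
    simp only [hω, h, tendsto_const_nhds]
  have hx : μ.real {ω | X 0 ω = x} ≠ 0 := (div_ne_zero_iff.1 h).2
  filter_upwards [ae_tendsto_frequency_state hXm hX x, ae_tendsto_frequency hXm hX
    (measurableSet_transition x x')] with ω hstate htransition
  refine ((htransition.comp (tendsto_sub_atTop_nat 1)).div hstate hx).congr' ?_
  filter_upwards [(tendsto_sub_atTop_nat 1).eventually_ne_atTop 0] with n hn
  exact div_div_div_cancel_right₀ (Nat.cast_ne_zero.2 hn) _ _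

variable [Fintype 𝒳]

lemma ae_eventually_empiricalMatrix_mem_stdSimplex (hXm : ∀ i, Measurable (X i))
    (hX : StationaryErgodic μ X) {x : 𝒳} (hx : oneStepMatrix μ X x ∈ stdSimplex ℝ 𝒳) :
    ∀ᵐ ω ∂μ, ∀ᶠ n in atTop, empiricalMatrix (fun i => X i ω) n x ∈ stdSimplex ℝ 𝒳 := by
  filter_upwards [ae_tendsto_frequency_state hXm hX x] with ω hω
  filter_upwards
    [hω.eventually_ne (measureReal_ne_zero_of_oneStepMatrix_mem_stdSimplex hx)] with n hn
  exact empiricalMatrix_mem_stdSimplex (Nat.cast_ne_zero.1 (div_ne_zero_iff.1 hn).1)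

omit [DecidableEq 𝒳] in
lemma exists_stationary_oneStepMatrix (hXm : ∀ i, Measurable (X i)) (hX : StationaryErgodic μ X)
    (hP : ∀ x, oneStepMatrix μ X x ∈ stdSimplex ℝ 𝒳) :
    ∃ m ∈ stdSimplex ℝ 𝒳, (∀ x, 0 < m x) ∧ m ᵥ* oneStepMatrix μ X = m := by
  refine ⟨fun x => μ.real {ω | X 0 ω = x}, ⟨fun _ => measureReal_nonneg, ?_⟩, fun x =>
    measureReal_nonneg.lt_of_ne' (measureReal_ne_zero_of_oneStepMatrix_mem_stdSimplex (hP x)), ?_⟩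
  · simpa only [Set.mem_univ, and_true, probReal_univ] using
      sum_measureReal_eq_and (μ := μ) (hXm 0) Set.univ
  · simpa only [measureReal_one_eq hXm hX] using law_vecMul_oneStepMatrix (μ := μ) (hXm 0)

theorem ae_stochasticApprox_empiricalMatrix (hXm : ∀ i, Measurable (X i))
    (hX : StationaryErgodic μ X) :
    ∀ᵐ ω ∂μ, StochasticApprox (fun n => empiricalMatrix (fun i => X i ω) n)
      (oneStepMatrix μ X) := by
  have htendsto := ae_all_iff.2 fun x => ae_all_iff.2 (ae_tendsto_empiricalMatrix_apply hXm hX x)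
  have hsupport : ∀ᵐ ω ∂μ, ∀ x x', oneStepMatrix μ X x x' = 0 →
      ∀ n, empiricalMatrix (fun i => X i ω) n x x' = 0 :=
    ae_all_iff.2 fun _ => ae_all_iff.2 fun _ =>
      eventually_imp_distrib_left.2 (ae_empiricalMatrix_eq_zero hXm hX)
  have hstochastic : ∀ᵐ ω ∂μ, ∀ x, oneStepMatrix μ X x ∈ stdSimplex ℝ 𝒳 →
      ∀ᶠ n in atTop, empiricalMatrix (fun i => X i ω) n x ∈ stdSimplex ℝ 𝒳 :=
    ae_all_iff.2 fun _ => eventually_imp_distrib_left.2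
      (ae_eventually_empiricalMatrix_mem_stdSimplex hXm hX)
  filter_upwards [htendsto, hsupport, hstochastic] with ω htendsto hsupport hstochastic
  exact
    { tendsto := tendsto_pi_nhds.2 fun x => tendsto_pi_nhds.2 (htendsto x)
      eventually_support := .of_forall fun n x x' h => hsupport x x' h n
      eventually_stochastic := fun hP => eventually_all.2 fun x => hstochastic x (hP x)
      exists_stationary := exists_stationary_oneStepMatrix hXm hX }

end Stationary

end Observations

end OTC

theorem mainTheorem3 {Ω 𝒳 𝒴 : Type*} [MeasurableSpace Ω]
    [Fintype 𝒳] [DecidableEq 𝒳] [MeasurableSpace 𝒳] [MeasurableSingletonClass 𝒳]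
    [Fintype 𝒴] [DecidableEq 𝒴] [MeasurableSpace 𝒴] [MeasurableSingletonClass 𝒴]
    (μ : Measure Ω) [IsProbabilityMeasure μ] (c : 𝒳 × 𝒴 → ℝ)
    (X : ℕ → Ω → 𝒳) (Y : ℕ → Ω → 𝒴)
    (hXm : ∀ i, Measurable (X i)) (hYm : ∀ i, Measurable (Y i))
    (hX : OTC.StationaryErgodic μ X) (hY : OTC.StationaryErgodic μ Y)
    (P : Matrix 𝒳 𝒳 ℝ) (Q : Matrix 𝒴 𝒴 ℝ)
    (hP : P = OTC.oneStepMatrix μ X) (hQ : Q = OTC.oneStepMatrix μ Y)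
    (Phat : ℕ → Ω → Matrix 𝒳 𝒳 ℝ) (Qhat : ℕ → Ω → Matrix 𝒴 𝒴 ℝ)
    (hPhat : ∀ n ω, Phat n ω = OTC.empiricalMatrix (fun i => X i ω) n)
    (hQhat : ∀ n ω, Qhat n ω = OTC.empiricalMatrix (fun i => Y i ω) n) :
    ∀ᵐ ω ∂μ,
      (Tendsto (fun n => OTC.rho c (Phat n ω) (Qhat n ω)) atTop (𝓝 (OTC.rho c P Q)) ∧
        OTC.setLimsup (fun n => OTC.PhiStar c (Phat n ω) (Qhat n ω)) ⊆ OTC.PhiStar c P Q) ∧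
      ∀ η : ℝ, 0 < η →
        Tendsto (fun n => OTC.rhoEta c η (Phat n ω) (Qhat n ω)) atTop
            (𝓝 (OTC.rhoEta c η P Q)) ∧
          OTC.setLimsup (fun n => OTC.PhiStarEta c η (Phat n ω) (Qhat n ω)) ⊆
            OTC.PhiStarEta c η P Q := by
  filter_upwards [OTC.ae_stochasticApprox_empiricalMatrix hXm hX,
    OTC.ae_stochasticApprox_empiricalMatrix hYm hY] with ω hωX hωY
  simp only [← hPhat, ← hQhat, ← hP, ← hQ] at hωX hωY
  refine ⟨?_, fun η hη => OTC.klTransitionCouplings_stability c (EReal.coe_pos.2 hη) hωX hωY⟩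
  have hunconstrained := OTC.klTransitionCouplings_stability c EReal.zero_lt_top hωX hωY
  simp only [OTC.klTransitionCouplings_top] at hunconstrained
  exact hunconstrained
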